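/- Let \(\mathfrak T\) be a triangulated category with suspension \(\Sigma\), and let \(\mathfrak I\) be a homological ideal in \(\mathfrak T\), that is, an ideal of morphisms of the form \(\mathfrak I=\ker F=\{f \mid F(f)=0\}\) for a stable homological functor \(F\colon\mathfrak T\to\mathfrak A\) into an abelian category \(\mathfrak A\) equipped with a suspension (a homological functor together with a natural isomorphism \(F\Sigma\cong\Sigma F\)). For a chain complex \(C_\bullet=(\dotsb\to C_{n+1}\xrightarrow{d_{n+1}}C_n\xrightarrow{d_n}C_{n-1}\to\dotsb)\), indexed by \(n\in\mathbb Z\), over \(\mathfrak T\), embed each \(d_n\) in an exact triangle \(C_n\xrightarrow{d_n}C_{n-1}\xrightarrow{f_n}X_n\xrightarrow{g_n}\Sigma C_n\). The complex \(C_\bullet\) is called \(\mathfrak I\)-exact in degree \(n\) if the composite \(X_n\xrightarrow{g_n}\Sigma C_n\xrightarrow{\Sigma f_{n+1}}\Sigma X_{n+1}\) belongs to \(\mathfrak I\); this does not depend on the choice of the triangles. It is called \(\mathfrak I\)-exact if it is \(\mathfrak I\)-exact in all degrees. The \(\mathfrak I\)-exact chain complexes form a triangulated subcategory of the homotopy category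 \(\mathfrak{Ho}(\mathfrak T)\) of chain complexes over \(\mathfrak T\); let \(\mathfrak{Der}=\mathfrak{Der}(\mathfrak T,\mathfrak I)\) be the (Verdier) localisation of the triangulated category \(\mathfrak{Ho}(\mathfrak T)\) at this subcategory. For \(n\in\mathbb Z\), let \(\mathfrak{Der}^{\ge n}\) and \(\mathfrak{Der}^{\le n}\) be the full subcategories, closed under isomorphism, of \(\mathfrak{Der}\) of those chain complexes that are \(\mathfrak I\)-exact in all degrees less than \(n\) and in all degrees greater than \(n\), respectively. Theorem. The pair of subcategories \(\mathfrak{Der}^{\ge 0}\), \(\mathfrak{Der}^{\le 0}\) is a t-structure on \(\mathfrak{Der}\) in the sense of Beilinson, Bernstein and Deligne, whose shifts are the subcategories \(\mathfrak{Der}^{\ge n}\), \(\mathfrak{Der}^{\le n}\). That is: \(\Sigma^m\mathfrak{Der}^{\ge n}=\mathfrak{Der}^{\ge n+m}\) and \(\Sigma^m\mathfrak{Der}^{\le n}=\mathfrak{Der}^{\le n+m}\) for all \(m,n\in\mathbb Z\); \(\mathfrak{Der}^{\ge 0}\subseteq\mathfrak{Der}^{\ge -1}\) and \(\mathfrak{Der}^{\le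 -1}\subseteq\mathfrak{Der}^{\le 0}\); every morphism in \(\mathfrak{Der}\) from an object of \(\mathfrak{Der}^{\ge 0}\) to an object of \(\mathfrak{Der}^{\le -1}\) is zero; and every object \(C\) of \(\mathfrak{Der}\) sits in an exact triangle \(A\to C\to B\to\Sigma A\) with \(A\in\mathfrak{Der}^{\ge 0}\) and \(B\in\mathfrak{Der}^{\le -1}\). -/

import Mathlib

open CategoryTheory Category Limits Pretriangulated Triangulated

universe w' w v u

noncomputable section

namespace RelHomAlg

/-- An ideal in a preadditive category: a family of subgroups of the morphism groups
that is closed under composition with arbitrary morphisms on both sides. -/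
@[ext]
structure MorphismIdeal (C : Type u) [Category.{v} C] [Preadditive C] where
  /-- the subgroup of morphisms `A ⟶ B` that belong to the ideal -/
  hom (A B : C) : AddSubgroup (A ⟶ B)
  comp_mem {A B C' D : C} (f : A ⟶ B) (g : B ⟶ C') (h : C' ⟶ D) (hg : g ∈ hom B C') :
    f ≫ g ≫ h ∈ hom A D

/-- The kernel on morphisms of an additive functor. -/
def morphismKernel {C : Type u} [Category.{v} C] [Preadditive C] {D : Type w}
    [Category.{w'} D] [Preadditive D] (F : C ⥤ D) [F.Additive] : MorphismIdeal C where
  hom A B := (F.mapAddHom (X := A) (Y := B)).ker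
  comp_mem f g h hg := by
    rw [AddMonoidHom.mem_ker] at hg ⊢
    have hg' : F.map g = 0 := hg
    change F.map (f ≫ g ≫ h) = 0
    simp [hg']

section

variable {T : Type u} [Category.{v} T] [HasZeroObject T] [Preadditive T] [HasShift T ℤ]
  [∀ n : ℤ, (shiftFunctor T n).Additive] [Pretriangulated T]

/-- An ideal `I` in a triangulated category is homological if it is the kernel of a stable
homological functor, that is, of a homological functor `F` to an abelian category `A` with a
suspension `S`, such that `F` intertwines the suspensions up to a natural isomorphism.
(A self-equivalence `S` of an abelian category is automatically additive.) -/
def MorphismIdeal.IsHomological (I : MorphismIdeal T) : Prop :=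
  ∃ (A : Type w) (_ : Category.{w'} A) (_ : Abelian A) (S : A ≌ A) (F : T ⥤ A)
    (_ : F.IsHomological),
    Nonempty (shiftFunctor T (1 : ℤ) ⋙ F ≅ F ⋙ S.functor) ∧ I = morphismKernel F

variable (T) in
/-- A homological ideal in a triangulated category. The universe levels `w`, `w'` are those of
the abelian category in which a defining stable homological functor takes its values. -/
structure HomologicalIdeal extends MorphismIdeal T where
  isHomological : MorphismIdeal.IsHomological.{w', w} toMorphismIdeal

/-- A chain complex `⋯ ⟶ C_{n+1} ⟶ C_n ⟶ C_{n-1} ⟶ ⋯` is encoded as the cochain complex `K`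
with `K.X (-n) = C_n`, so that `d_n : C_n ⟶ C_{n-1}` is `K.d (-n) (-(n-1))`.

The complex is `I`-exact in (homological) degree `n` if, for distinguished triangles
`C_n --d_n--> C_{n-1} --f--> X --g--> C_n⟦1⟧` and
`C_{n+1} --d_{n+1}--> C_n --f'--> X' --g'--> C_{n+1}⟦1⟧`, the composite
`X --g--> C_n⟦1⟧ --f'⟦1⟧--> X'⟦1⟧` belongs to `I`. -/
def IsExactInDegree (I : MorphismIdeal T) (K : CochainComplex T ℤ) (n : ℤ) : Prop :=
  ∃ (X X' : T) (f : K.X (-(n - 1)) ⟶ X) (g : X ⟶ (K.X (-n))⟦(1 : ℤ)⟧)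
    (f' : K.X (-n) ⟶ X') (g' : X' ⟶ (K.X (-(n + 1)))⟦(1 : ℤ)⟧),
    Triangle.mk (K.d (-n) (-(n - 1))) f g ∈ distTriang T ∧
    Triangle.mk (K.d (-(n + 1)) (-n)) f' g' ∈ distTriang T ∧
    g ≫ f'⟦(1 : ℤ)⟧' ∈ I.hom X (X'⟦(1 : ℤ)⟧)

lemma exact_aux {A : Type w} [Category.{w'} A] [Abelian A] {Y Z B W V : A}
    {u : Y ⟶ Z} {d₀ : Z ⟶ B} {d₁ : W ⟶ Z} {f : Z ⟶ V}
    (h₁ : ∃ w, (ShortComplex.mk u d₀ w).Exact) (h₂ : ∃ w, (ShortComplex.mk d₁ f w).Exact)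
    (w : d₁ ≫ d₀ = 0) : u ≫ f = 0 ↔ (ShortComplex.mk d₁ d₀ w).Exact := by
  obtain ⟨w₁, h₁⟩ := h₁
  obtain ⟨w₂, h₂⟩ := h₂
  rw [ShortComplex.exact_iff_exact_up_to_refinements] at h₁ h₂ ⊢
  dsimp at h₁ h₂ ⊢
  constructor
  · intro h P x hx
    obtain ⟨P', π, hπ, y, hy⟩ := h₁ x hx
    obtain ⟨P'', π', hπ', z, hz⟩ := h₂ (π ≫ x) (by simp [hy, h])
    exact ⟨P'', π' ≫ π, inferInstance, z, by simpa using hz⟩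
  · intro h
    obtain ⟨P, π, hπ, y, hy⟩ := h u w₁
    rw [← cancel_epi π, ← assoc, hy, assoc, w₂, comp_zero, comp_zero]

/-- Independence of the choice of the triangles, and comparison with exactness after applying
a stable homological functor. -/
lemma exact_iff_of_triangles {A : Type w} [Category.{w'} A] [Abelian A] (S : A ≌ A) (F : T ⥤ A)
    [F.IsHomological] (e : shiftFunctor T (1 : ℤ) ⋙ F ≅ F ⋙ S.functor)
    {Y Z B X X' : T} {d₁ : Y ⟶ Z} {d₀ : Z ⟶ B} {f : B ⟶ X} {g : X ⟶ Z⟦(1 : ℤ)⟧}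
    {f' : Z ⟶ X'} {g' : X' ⟶ Y⟦(1 : ℤ)⟧}
    (h₀ : Triangle.mk d₀ f g ∈ distTriang T) (h₁ : Triangle.mk d₁ f' g' ∈ distTriang T)
    (w : F.map d₁ ≫ F.map d₀ = 0) :
    F.map (g ≫ f'⟦(1 : ℤ)⟧') = 0 ↔ (ShortComplex.mk (F.map d₁) (F.map d₀) w).Exact := by
  have h₃ : ∃ w, (ShortComplex.mk (F.map g) (F.map (-d₀⟦(1 : ℤ)⟧')) w).Exact :=
    ⟨_, F.map_distinguished_exact _ (rot_of_distTriang _ (rot_of_distTriang _ h₀))⟩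
  have h₄ : ∃ w, (ShortComplex.mk (F.map (-d₁⟦(1 : ℤ)⟧')) (F.map (-f'⟦(1 : ℤ)⟧')) w).Exact :=
    ⟨_, F.map_distinguished_exact _
      (rot_of_distTriang _ (rot_of_distTriang _ (rot_of_distTriang _ h₁)))⟩
  have n₁ : F.map (d₁⟦(1 : ℤ)⟧') ≫ e.hom.app Z = e.hom.app Y ≫ S.functor.map (F.map d₁) :=
    e.hom.naturality d₁
  have n₀ : F.map (d₀⟦(1 : ℤ)⟧') ≫ e.hom.app B = e.hom.app Z ≫ S.functor.map (F.map d₀) :=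
    e.hom.naturality d₀
  have w' : F.map (-d₁⟦(1 : ℤ)⟧') ≫ F.map (-d₀⟦(1 : ℤ)⟧') = 0 := by
    rw [F.map_neg, F.map_neg, Preadditive.neg_comp_neg, ← cancel_mono (e.hom.app _), assoc, n₀,
      reassoc_of% n₁, ← S.functor.map_comp, w]
    simp
  have h₅ : F.map (g ≫ f'⟦(1 : ℤ)⟧') = 0 ↔ F.map g ≫ F.map (-f'⟦(1 : ℤ)⟧') = 0 := by
    rw [F.map_neg, Preadditive.comp_neg, neg_eq_zero, F.map_comp]
  rw [h₅, exact_aux h₃ h₄ w', ← ShortComplex.exact_map_iff_of_faithful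
    (ShortComplex.mk (F.map d₁) (F.map d₀) w) S.functor]
  let i : F.obj (Z⟦(1 : ℤ)⟧) ≅ S.functor.obj (F.obj Z) :=
    ⟨-e.hom.app Z, -e.inv.app Z,
      by rw [Preadditive.neg_comp_neg]; exact e.hom_inv_id_app Z,
      by rw [Preadditive.neg_comp_neg]; exact e.inv_hom_id_app Z⟩
  refine ShortComplex.exact_iff_of_iso (ShortComplex.isoMk (e.app Y) i (e.app B) ?_ ?_)
  · change e.hom.app Y ≫ S.functor.map (F.map d₁) = F.map (-d₁⟦(1 : ℤ)⟧') ≫ (-e.hom.app Z)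
    rw [F.map_neg, Preadditive.neg_comp_neg, n₁]
  · change (-e.hom.app Z) ≫ S.functor.map (F.map d₀) = F.map (-d₀⟦(1 : ℤ)⟧') ≫ e.hom.app B
    rw [F.map_neg, Preadditive.neg_comp, Preadditive.neg_comp, n₀]

lemma isExactInDegree_iff {I : MorphismIdeal T} {A : Type w} [Category.{w'} A] [Abelian A]
    (S : A ≌ A) (F : T ⥤ A) [F.IsHomological]
    (e : shiftFunctor T (1 : ℤ) ⋙ F ≅ F ⋙ S.functor) (hI : I = morphismKernel F)
    (K : CochainComplex T ℤ) (n : ℤ) :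
    IsExactInDegree I K n ↔
      ((F.mapHomologicalComplex (ComplexShape.up ℤ)).obj K).ExactAt (-n) := by
  rw [HomologicalComplex.exactAt_iff' _ (-(n + 1)) (-n) (-(n - 1)) (by simp; lia) (by simp; lia)]
  have hmem : ∀ {X Y : T} (f : X ⟶ Y), f ∈ I.hom X Y ↔ F.map f = 0 := by
    rintro X Y f
    subst hI
    exact Iff.rfl
  have w : F.map (K.d (-(n + 1)) (-n)) ≫ F.map (K.d (-n) (-(n - 1))) = 0 := by
    rw [← F.map_comp, K.d_comp_d, F.map_zero]
  constructor
  · rintro ⟨X, X', f, g, f', g', h₀, h₁, h⟩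
    exact (exact_iff_of_triangles S F e h₀ h₁ w).1 ((hmem _).1 h)
  · intro h
    obtain ⟨X, f, g, h₀⟩ := distinguished_cocone_triangle (K.d (-n) (-(n - 1)))
    obtain ⟨X', f', g', h₁⟩ := distinguished_cocone_triangle (K.d (-(n + 1)) (-n))
    exact ⟨X, X', f, g, f', g', h₀, h₁,
      (hmem _).2 ((exact_iff_of_triangles S F e h₀ h₁ w).2 h)⟩

variable (T) in
/-- The homotopy category of chain complexes over `T`. -/
abbrev Ho := HomotopyCategory T (ComplexShape.up ℤ)

/-- The full subcategory of `Ho T` of the `I`-exact chain complexes. -/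
def exactComplexes (I : MorphismIdeal T) : ObjectProperty (Ho T) :=
  fun K => ∀ n : ℤ, IsExactInDegree I K.as n

/-- The `I`-exact chain complexes form a triangulated subcategory of `Ho T`. -/
instance (I : HomologicalIdeal.{w', w} T) :
    (exactComplexes I.toMorphismIdeal).IsTriangulated := by
  obtain ⟨A, _, _, S, F, _, ⟨e⟩, hI⟩ := I.isHomological
  have : exactComplexes I.toMorphismIdeal =
      (HomotopyCategory.subcategoryAcyclic A).inverseImage
        (F.mapHomotopyCategory (ComplexShape.up ℤ)) := by
    ext K
    obtain ⟨K, rfl⟩ := HomotopyCategory.quotient_obj_surjective K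
    rw [ObjectProperty.prop_inverseImage_iff]
    change _ ↔ HomotopyCategory.subcategoryAcyclic A
      ((HomotopyCategory.quotient _ _).obj ((F.mapHomologicalComplex _).obj K))
    rw [HomotopyCategory.quotient_obj_mem_subcategoryAcyclic_iff_acyclic]
    constructor
    · intro h n
      simpa using (isExactInDegree_iff S F e hI K (-n)).1 (h (-n))
    · intro h n
      exact (isExactInDegree_iff S F e hI K n).2 (h (-n))
  rw [this]
  infer_instance

/-- The derived category of `T` with respect to `I`: the localization of `Ho T` at the
triangulated subcategory of `I`-exact chain complexes, that is, at the morphisms whose cone is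
`I`-exact. It carries the triangulated structure of a Verdier quotient. -/
abbrev Der (I : HomologicalIdeal.{w', w} T) : Type (max u v) :=
  (exactComplexes I.toMorphismIdeal).trW.Localization

/-- The chain complex `K`, as an object of the derived category. -/
abbrev Der.ofComplex (I : HomologicalIdeal.{w', w} T) (K : CochainComplex T ℤ) : Der I :=
  (exactComplexes I.toMorphismIdeal).trW.Q.obj
    ((HomotopyCategory.quotient T (ComplexShape.up ℤ)).obj K)

/-- The (strictly full) subcategory `Der^{≥ n}` of chain complexes that are `I`-exact in
homological degrees less than `n`. -/
def derGE (I : HomologicalIdeal.{w', w} T) (n : ℤ) : ObjectProperty (Der I) :=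
  fun X => ∃ K : CochainComplex T ℤ, Nonempty (X ≅ Der.ofComplex I K) ∧
    ∀ m : ℤ, m < n → IsExactInDegree I.toMorphismIdeal K m

/-- The (strictly full) subcategory `Der^{≤ n}` of chain complexes that are `I`-exact in
homological degrees greater than `n`. -/
def derLE (I : HomologicalIdeal.{w', w} T) (n : ℤ) : ObjectProperty (Der I) :=
  fun X => ∃ K : CochainComplex T ℤ, Nonempty (X ≅ Der.ofComplex I K) ∧
    ∀ m : ℤ, n < m → IsExactInDegree I.toMorphismIdeal K m

end

end RelHomAlg

end

/-!
Let `F` be a stable homological functor with kernel `I`. Then a complex `K` is `I`-exact in a given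
degree if and only if `F(K)` is exact there, so that the claim concerns the homology of `F(K)`.
Degrees are cohomological below.

Keep the part of `K` in high degrees and continue it downwards by iterated weak kernels. This gives
`π : K ⟶ L`, invertible in high degrees, where `L` is weakly exact in low degrees: there each
differential is a weak kernel of the next one, and hence `F(L)` is exact. So `π` truncates the
homology of `F(K)`, and the fibre of `π` carries the complementary part; this is the required
triangle. Weak exactness is moreover enough to lift maps and homotopies by descending recursion, so
that every map from `K` to a complex that is weakly exact in low degrees factors through `π` up to
homotopy.

A map in the derived category from low to high homology is represented by a right fraction whose
target may be taken weakly exact in low degrees, replacing it by its truncation. It then factors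
through the truncation of its source, which is `I`-exact, and so it vanishes.
-/

noncomputable section

namespace RelHomAlg

section Descent

variable {X : ℤ → Type*}

/-- The family indexed by `ℤ` which is prescribed from the index `n` on and continued to smaller
indices by descending recursion. -/
def descend (n : ℤ) (x₀ : ∀ i, n ≤ i → X i) (step : ∀ i, i < n → X (i + 1) → X i) (i : ℤ) : X i :=
  if h : n ≤ i then x₀ i h else step i (not_le.1 h) (descend n x₀ step (i + 1))
termination_by (n - i).toNat

lemma exists_extend_downward {R : ∀ i, X i → X (i + 1) → Prop} (n : ℤ) (x₀ : ∀ i, n ≤ i → X i)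
    (h₀ : ∀ i (hi : n ≤ i), R i (x₀ i hi) (x₀ (i + 1) (hi.trans (Int.le_add_one le_rfl))))
    (step : ∀ i, i < n → ∀ b c, R (i + 1) b c → ∃ a, R i a b) :
    ∃ x : ∀ i, X i, (∀ i hi, x i = x₀ i hi) ∧ ∀ i, R i (x i) (x (i + 1)) := by
  choose s hs using fun i hi (b : { b : X (i + 1) // ∃ c, R (i + 1) b c }) =>
    step i hi b.1 b.2.choose b.2.choose_spec
  let x := descend (X := fun i => { b : X i // ∃ c, R i b c }) n
    (fun i hi => ⟨x₀ i hi, _, h₀ i hi⟩) (fun i hi b => ⟨s i hi b, b, hs i hi b⟩)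
  have x_of_le (i : ℤ) (hi : n ≤ i) : (x i : X i) = x₀ i hi := by
    simp only [x]
    rw [descend, dif_pos hi]
  refine ⟨fun i => x i, x_of_le, fun i => ?_⟩
  beta_reduce
  by_cases hi : n ≤ i
  · rw [x_of_le i hi, x_of_le (i + 1) (by lia)]
    exact h₀ i hi
  · have x_of_lt : (x i : X i) = s i (not_le.1 hi) (x (i + 1)) := by
      simp only [x]
      rw [descend, dif_neg hi]
    rw [x_of_lt]
    exact hs i _ _

end Descent

section WeaklyExact

variable {V : Type*} [Category* V] [Preadditive V]

/-- A short complex is weakly exact if its first morphism is a weak kernel of the second one. -/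
def IsWeaklyExact (S : ShortComplex V) : Prop :=
  ∀ ⦃W : V⦄ (x : W ⟶ S.X₂), x ≫ S.g = 0 → ∃ y : W ⟶ S.X₁, y ≫ S.f = x

/-- A cochain complex is weakly exact up to degree `n` if in every degree `j ≤ n` the incoming
differential is a weak kernel of the outgoing one. -/
def IsWeaklyExactUpTo (n : ℤ) (K : CochainComplex V ℤ) : Prop :=
  ∀ i j k, i + 1 = j → j + 1 = k → j ≤ n → IsWeaklyExact (K.sc' i j k)

variable {K L M : CochainComplex V ℤ} {n : ℤ}

lemma isWeaklyExactUpTo_iff : IsWeaklyExactUpTo n K ↔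
    ∀ i, i < n → ∀ ⦃W : V⦄ (x : W ⟶ K.X (i + 1)), x ≫ K.d (i + 1) (i + 1 + 1) = 0 →
      ∃ y : W ⟶ K.X i, y ≫ K.d i (i + 1) = x :=
  ⟨fun h i hi => h i (i + 1) (i + 1 + 1) rfl rfl hi, by rintro h i _ _ rfl rfl hi; exact h i hi⟩

lemma IsWeaklyExactUpTo.exists_hom_extending (hL : IsWeaklyExactUpTo n L)
    (g : ∀ i, n ≤ i → (K.X i ⟶ L.X i))
    (hg : ∀ i hi, g i hi ≫ L.d i (i + 1) =
      K.d i (i + 1) ≫ g (i + 1) (hi.trans (Int.le_add_one le_rfl))) :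
    ∃ φ : K ⟶ L, ∀ i hi, φ.f i = g i hi := by
  obtain ⟨f, hf, comm⟩ := exists_extend_downward (X := fun i => K.X i ⟶ L.X i)
    (R := fun i a b => a ≫ L.d i (i + 1) = K.d i (i + 1) ≫ b) n g hg fun i hi b c hbc =>
      isWeaklyExactUpTo_iff.1 hL i hi (K.d i (i + 1) ≫ b)
        (by rw [assoc, hbc, K.d_comp_d_assoc, zero_comp])
  exact ⟨{ f, comm' := by rintro i _ rfl; exact comm i }, hf⟩

lemma IsWeaklyExactUpTo.nonempty_homotopy_zero (hL : IsWeaklyExactUpTo n L) (φ : K ⟶ L)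
    (hφ : ∀ i, n < i → φ.f i = 0) : Nonempty (Homotopy φ 0) := by
  obtain ⟨h, -, hh⟩ := exists_extend_downward (X := fun i => K.X (i + 1) ⟶ L.X i)
    (R := fun i a b => φ.f (i + 1) = K.d (i + 1) (i + 1 + 1) ≫ b + a ≫ L.d i (i + 1)) n
    (fun _ _ => 0) (fun i hi => by simp [hφ (i + 1) (by lia)]) fun i hi b c hbc => by
      obtain ⟨a, ha⟩ := isWeaklyExactUpTo_iff.1 hL i hi
        (φ.f (i + 1) - K.d (i + 1) (i + 1 + 1) ≫ b) (by
          rw [Preadditive.sub_comp, φ.comm, hbc]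
          simp)
      exact ⟨a, eq_add_of_sub_eq' ha.symm⟩
  exact ⟨{
    hom i j := if hij : j + 1 = i then (K.XIsoOfEq hij).inv ≫ h j else 0
    zero i j hij := dif_neg hij
    comm i := by
      obtain ⟨j, rfl⟩ : ∃ j, i = j + 1 := ⟨i - 1, by lia⟩
      rw [dNext_eq _ (show (ComplexShape.up ℤ).Rel (j + 1) (j + 1 + 1) from rfl),
        prevD_eq _ (show (ComplexShape.up ℤ).Rel j (j + 1) from rfl)]
      simpa using hh j }⟩

lemma IsWeaklyExactUpTo.exists_factorization_up_to_homotopy (hM : IsWeaklyExactUpTo n M)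
    (π : K ⟶ L) (hπ : ∀ i, n ≤ i → IsIso (π.f i)) (f : K ⟶ M) :
    ∃ g : L ⟶ M, Nonempty (Homotopy (π ≫ g) f) := by
  obtain ⟨g, hg⟩ := hM.exists_hom_extending (K := L)
    (fun i hi => haveI := hπ i hi; inv (π.f i) ≫ f.f i) fun i hi => by
      have := hπ i hi
      have := hπ (i + 1) (by lia)
      rw [← cancel_epi (π.f i)]
      simp
  obtain ⟨h⟩ := hM.nonempty_homotopy_zero (π ≫ g - f) fun i hi => by
    have := hπ i hi.le
    simp [hg i hi.le]
  exact ⟨g, ⟨Homotopy.equivSubZero.symm h⟩⟩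

end WeaklyExact

section WeakTruncation

variable {V : Type*} [Category* V] [Preadditive V] [HasWeakKernels V]

lemma exists_weakTruncation (K : CochainComplex V ℤ) (n : ℤ) :
    ∃ (L : CochainComplex V ℤ) (π : K ⟶ L),
      (∀ i, n ≤ i → IsIso (π.f i)) ∧ IsWeaklyExactUpTo n L := by
  obtain ⟨a, ha, hR⟩ := exists_extend_downward (X := fun _ => Arrow V)
    (R := fun i a b => ∃ h : a.right = b.left, ∃ w : (a.hom ≫ eqToHom h) ≫ b.hom = 0,
      i < n → IsWeaklyExact (.mk (a.hom ≫ eqToHom h) b.hom w)) n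
    (fun i _ => Arrow.mk (K.d i (i + 1)))
    (fun i hi => ⟨rfl, by simp, fun h => (h.not_ge hi).elim⟩)
    fun i _ b c _ => ⟨Arrow.mk (weakKernel.ι b.hom), rfl,
      by simp [weakKernel.condition], fun _ W x hx => ⟨weakKernel.lift _ x hx, by simp⟩⟩
  choose h w hw using hR
  let d (i : ℤ) : (a i).left ⟶ (a (i + 1)).left := (a i).hom ≫ eqToHom (h i)
  let L : CochainComplex V ℤ :=
    CochainComplex.of (fun i => (a i).left) d fun i => by simp only [d, ← assoc, w, zero_comp]
  have L_d (i : ℤ) : L.d i (i + 1) = (a i).hom ≫ eqToHom (h i) := CochainComplex.of_d _ d i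
  have hL : IsWeaklyExactUpTo n L := isWeaklyExactUpTo_iff.2 fun i hi W x hx => by
    have hx' : x ≫ d (i + 1) = 0 := (x ≫= L_d (i + 1)).symm.trans hx
    obtain ⟨y, hy⟩ := hw i hi x ((cancel_mono (eqToHom (h (i + 1)))).1 (by simpa [d] using hx'))
    exact ⟨y, (y ≫= L_d i).trans hy⟩
  have a_hom (i : ℤ) (hi : n ≤ i) := (Arrow.mk_eq_mk_iff (a i).hom _).1 (ha i hi)
  obtain ⟨π, hπ⟩ := hL.exists_hom_extending (K := K) (fun i hi => eqToHom (a_hom i hi).1.symm)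
    fun i hi => by
      obtain ⟨_, _, hai⟩ := a_hom i hi
      simp [L_d, hai]
  refine ⟨L, π, fun i hi => ?_, hL⟩
  rw [hπ i hi]
  infer_instance

end WeakTruncation

section Homology

variable {C A : Type*} [Category* C] [HasShift C ℤ] [Category* A]

section

variable (H : C ⥤ A) [H.ShiftSequence ℤ]

/-- The objects whose homology with respect to `H` vanishes in all degrees greater than `n`. -/
def homologyLE (n : ℤ) : ObjectProperty C := fun X => ∀ m, n < m → IsZero ((H.shift m).obj X)

/-- The objects whose homology with respect to `H` vanishes in all degrees less than `n`. -/
def homologyGE (n : ℤ) : ObjectProperty C := fun X => ∀ m, m < n → IsZero ((H.shift m).obj X)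

lemma homologyLE_monotone : Monotone (homologyLE H) :=
  fun _ _ h _ hX m hm => hX m (h.trans_lt hm)

lemma homologyGE_antitone : Antitone (homologyGE H) :=
  fun _ _ h _ hX m hm => hX m (hm.trans_le h)

variable {H} {n a n' : ℤ} {X Y : C}

lemma homologyLE_shift (h : a + n' = n) (hX : homologyLE H n X) : homologyLE H n' (X⟦a⟧) :=
  fun m hm => (hX (a + m) (by lia)).of_iso ((H.shiftIso a m _ rfl).app X)

lemma homologyGE_shift (h : a + n' = n) (hX : homologyGE H n X) : homologyGE H n' (X⟦a⟧) :=
  fun m hm => (hX (a + m) (by lia)).of_iso ((H.shiftIso a m _ rfl).app X)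

lemma homologicalKernel_of_homologyLE_of_homologyGE [Preadditive C] (hLE : homologyLE H n X)
    (hGE : homologyGE H (n + 1) X) : H.homologicalKernel X :=
  (H.mem_homologicalKernel_iff X).2 fun m =>
    (lt_or_ge n m).elim (hLE m) fun hm => hGE m (Int.lt_add_one_of_le hm)

end

variable [Preadditive C] {H : C ⥤ A} [H.ShiftSequence ℤ] {n : ℤ} {X Y : C}

variable (H n) in
/-- `π : X ⟶ Y` exhibits `Y` as the part of `X` in degrees greater than `n`, as far as the homology
with respect to `H` is concerned. -/
structure IsHomologyTruncation (π : X ⟶ Y) : Prop where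
  homologyGE_obj : homologyGE H (n + 1) Y
  isIso_map : ∀ m, n < m → IsIso ((H.shift m).map π)

namespace IsHomologyTruncation

variable {π : X ⟶ Y} (hπ : IsHomologyTruncation H n π)
include hπ

lemma homologicalKernel (hX : homologyLE H n X) : H.homologicalKernel Y :=
  homologicalKernel_of_homologyLE_of_homologyGE (fun m hm =>
    have := hπ.isIso_map m hm
    (hX m hm).of_iso (asIso ((H.shift m).map π)).symm) hπ.homologyGE_obj

variable [HasZeroObject C] [∀ n : ℤ, (shiftFunctor C n).Additive]
  [Pretriangulated C] [Abelian A] [H.IsHomological]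

lemma homologicalKernel_trW (hX : homologyGE H (n + 1) X) : H.homologicalKernel.trW π := by
  rw [H.mem_homologicalKernel_trW_iff]
  intro m
  obtain hm | hm := lt_or_ge n m
  · exact hπ.isIso_map m hm
  · exact (hX m (by lia)).isIso (hπ.homologyGE_obj m (by lia)) _

lemma homologyLE_of_distinguished {F : C} {i : F ⟶ X} {δ : Y ⟶ F⟦(1 : ℤ)⟧}
    (hT : Triangle.mk i π δ ∈ distTriang C) : homologyLE H n F := by
  intro m hm
  have h : m - 1 + 1 = m := by lia
  have epi : Epi ((H.shift (m - 1)).map π) := by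
    obtain hm' | hm' := lt_or_ge n (m - 1)
    · have := hπ.isIso_map _ hm'
      infer_instance
    · exact ⟨fun _ _ _ => (hπ.homologyGE_obj (m - 1) (by lia)).eq_of_src _ _⟩
  have mono : Mono ((H.shift m).map π) := by
    have := hπ.isIso_map m hm
    infer_instance
  exact (H.homologySequence_exact₁ _ hT _ _ h).isZero_of_both_zeros
    ((H.homologySequence_epi_shift_map_mor₂_iff _ hT _ _ h).1 epi)
    ((H.homologySequence_mono_shift_map_mor₂_iff _ hT _).1 mono)

end IsHomologyTruncation

variable (H n) in
/-- Every object `X` has a homology truncation `π : X ⟶ Y` with `Y` in the class `P`, such that all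
morphisms from `X` to objects of `P` factor through `π`, not necessarily uniquely. -/
def HasWeakTruncations (P : ObjectProperty C) : Prop :=
  ∀ X : C, ∃ (Y : C) (π : X ⟶ Y), P Y ∧ IsHomologyTruncation H n π ∧
    ∀ ⦃M : C⦄, P M → ∀ f : X ⟶ M, ∃ g : Y ⟶ M, π ≫ g = f

end Homology

section Localization

variable {C D A : Type*} [Category* C] [HasShift C ℤ] [Category* D] (L : C ⥤ D)

lemma map_shift_of_shift [HasShift D ℤ] [L.CommShift ℤ] {P Q : ObjectProperty C} {a : ℤ}
    (h : ∀ X, P X → Q (X⟦a⟧)) {Y : D} (hY : P.map L Y) : Q.map L (Y⟦a⟧) := by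
  obtain ⟨X, hX, ⟨e⟩⟩ := hY
  exact ⟨X⟦a⟧, h X hX, ⟨(L.commShiftIso a).app X ≪≫ (shiftFunctor D a).mapIso e⟩⟩

variable [HasZeroObject C] [Preadditive C] [∀ n : ℤ, (shiftFunctor C n).Additive]
  [Pretriangulated C] [Preadditive D]

open ZeroObject in
lemma isZero_obj_of_isLocalization_trW (P : ObjectProperty C) [L.IsLocalization P.trW]
    [L.PreservesZeroMorphisms] {X : C} (hX : P X) : IsZero (L.obj X) := by
  have : IsIso (L.map (0 : 0 ⟶ X)) := Localization.inverts L P.trW _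
    (ObjectProperty.trW.mk P (contractible_distinguished₁ X) hX)
  exact (L.map_isZero (isZero_zero C)).of_iso (asIso (L.map (0 : 0 ⟶ X))).symm

variable [Category* A] {H : C ⥤ A} [H.ShiftSequence ℤ]
  {n : ℤ} {P : ObjectProperty C}

namespace HasWeakTruncations

variable (hP : HasWeakTruncations H n P) {X Y : C}
include hP

lemma map_eq_zero [L.IsLocalization H.homologicalKernel.trW] [L.PreservesZeroMorphisms]
    (hX : homologyLE H n X) (hY : P Y) (f : X ⟶ Y) : L.map f = 0 := by
  obtain ⟨X', π, -, hπ, hfac⟩ := hP X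
  obtain ⟨g, rfl⟩ := hfac hY f
  have hX' := isZero_obj_of_isLocalization_trW L H.homologicalKernel (hπ.homologicalKernel hX)
  rw [L.map_comp, hX'.eq_of_tgt (L.map π) 0, zero_comp]

variable [Abelian A] [H.IsHomological]

lemma exists_truncation_triangle (X : C) : ∃ (Y Z : C) (_ : homologyLE H n Y)
    (_ : homologyGE H (n + 1) Z) (f : Y ⟶ X) (g : X ⟶ Z) (h : Z ⟶ Y⟦(1 : ℤ)⟧),
      Triangle.mk f g h ∈ distTriang C := by
  obtain ⟨Z, π, -, hπ, -⟩ := hP X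
  obtain ⟨Y, i, δ, hT⟩ := distinguished_cocone_triangle₁ π
  exact ⟨Y, Z, hπ.homologyLE_of_distinguished hT, hπ.homologyGE_obj, i, π, δ, hT⟩

variable [IsTriangulated C] [L.IsLocalization H.homologicalKernel.trW]
  [L.PreservesZeroMorphisms]

lemma hom_eq_zero_of_prop (hX : homologyLE H n X) (hY : P Y) (f : L.obj X ⟶ L.obj Y) : f = 0 := by
  obtain ⟨φ, hφ⟩ := Localization.exists_rightFraction L H.homologicalKernel.trW f
  have := Localization.inverts L _ φ.s φ.hs
  have hX' : homologyLE H n φ.X' := fun m hm =>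
    have := (H.mem_homologicalKernel_trW_iff φ.s).1 φ.hs m
    (hX m hm).of_iso (asIso ((H.shift m).map φ.s))
  rw [← cancel_epi (L.map φ.s), comp_zero, hφ, MorphismProperty.RightFraction.map_s_comp_map]
  exact hP.map_eq_zero L hX' hY φ.f

lemma hom_eq_zero (hX : homologyLE H n X) (hY : homologyGE H (n + 1) Y)
    (f : L.obj X ⟶ L.obj Y) : f = 0 := by
  obtain ⟨Y', π, hY', hπ, -⟩ := hP Y
  have := Localization.inverts L _ π (hπ.homologicalKernel_trW hY)
  rw [← cancel_mono (L.map π), zero_comp]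
  exact hP.hom_eq_zero_of_prop L hX hY' _

end HasWeakTruncations

variable [HasZeroObject D] [HasShift D ℤ] [∀ n : ℤ, (shiftFunctor D n).Additive]
  [Pretriangulated D] [IsTriangulated C] [Abelian A] [H.IsHomological] [L.CommShift ℤ]
  [L.IsTriangulated] [L.IsLocalization H.homologicalKernel.trW]

/-- The t-structure on the localization of `C` at the kernel of a homological functor `H` whose
aisle and coaisle consist of the objects with homology in nonpositive, respectively nonnegative,
degrees. -/
def truncationTStructure (hP : HasWeakTruncations H 0 P) : TStructure D where
  le n := (homologyLE H n).map L
  ge n := (homologyGE H n).map L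
  le_shift _ _ _ h _ hX := map_shift_of_shift L (fun _ => homologyLE_shift h) hX
  ge_shift _ _ _ h _ hX := map_shift_of_shift L (fun _ => homologyGE_shift h) hX
  zero' X Y f hX hY := by
    obtain ⟨X', hX', ⟨eX⟩⟩ := hX
    obtain ⟨Y', hY', ⟨eY⟩⟩ := hY
    rw [← cancel_epi eX.hom, ← cancel_mono eY.inv]
    simpa using hP.hom_eq_zero L hX' hY' (eX.hom ≫ f ≫ eY.inv)
  le_zero_le := ObjectProperty.map_monotone (homologyLE_monotone H zero_le_one) L
  ge_one_le := ObjectProperty.map_monotone (homologyGE_antitone H zero_le_one) L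
  exists_triangle_zero_one X := by
    have := Localization.essSurj L H.homologicalKernel.trW
    obtain ⟨Y, Z, hY, hZ, f, g, h, hT⟩ := hP.exists_truncation_triangle (L.objPreimage X)
    have hLT : Triangle.mk (L.map f) (L.map g) (L.map h ≫ (L.commShiftIso 1).hom.app Y) ∈
        distTriang D := L.map_distinguished _ hT
    let e := L.objObjPreimageIso X
    exact ⟨L.obj Y, L.obj Z, ObjectProperty.prop_map_obj _ L hY, ObjectProperty.prop_map_obj _ L hZ,
      L.map f ≫ e.hom, e.inv ≫ L.map g, L.map h ≫ (L.commShiftIso 1).hom.app Y,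
      isomorphic_distinguished _ hLT _ (Triangle.isoMk _ _ (Iso.refl _) e.symm (Iso.refl _)
        (by simp [e, Triangle.mk]) (by simp [e, Triangle.mk]) (by simp [Triangle.mk]))⟩

end Localization

section RelativeHomology

variable {V A : Type*} [Category* V] [Preadditive V] [Category* A] [Abelian A] (F : V ⥤ A)
  [F.Additive]

/-- The homology, in degree zero, of the image of a complex under the functor `F`. Its shifts are
the homology functors in the other degrees. -/
abbrev relHomology : HomotopyCategory V (ComplexShape.up ℤ) ⥤ A :=
  F.mapHomotopyCategory (ComplexShape.up ℤ) ⋙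
    HomotopyCategory.homologyFunctor A (ComplexShape.up ℤ) 0

lemma isZero_relHomology_shift_obj_iff (K : CochainComplex V ℤ) (n : ℤ) :
    IsZero (((relHomology F).shift n).obj ((HomotopyCategory.quotient V _).obj K)) ↔
      ((F.mapHomologicalComplex (ComplexShape.up ℤ)).obj K).ExactAt n := by
  rw [HomologicalComplex.exactAt_iff_isZero_homology]
  exact ((HomotopyCategory.homologyFunctorFactors A (ComplexShape.up ℤ) n).app
    ((F.mapHomologicalComplex (ComplexShape.up ℤ)).obj K)).isZero_iff

lemma isIso_relHomology_shift_map {K L : CochainComplex V ℤ} (φ : K ⟶ L) {n : ℤ}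
    (hφ : ∀ i, n - 1 ≤ i → IsIso (φ.f i)) :
    IsIso (((relHomology F).shift n).map ((HomotopyCategory.quotient V _).map φ)) := by
  let Fφ := (F.mapHomologicalComplex (ComplexShape.up ℤ)).map φ
  have quasiIsoAt : QuasiIsoAt Fφ n := by
    rw [quasiIsoAt_iff' _ (n - 1) n (n + 1) (by simp) (by simp)]
    let ψ := (HomologicalComplex.shortComplexFunctor' A (ComplexShape.up ℤ)
      (n - 1) n (n + 1)).map Fφ
    have isIso_map_f (i : ℤ) (hi : n - 1 ≤ i) : IsIso (F.map (φ.f i)) :=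
      have := hφ i hi
      inferInstance
    have : IsIso ψ.τ₁ := isIso_map_f (n - 1) le_rfl
    have : IsIso ψ.τ₂ := isIso_map_f n (by lia)
    have : IsIso ψ.τ₃ := isIso_map_f (n + 1) (by lia)
    exact ShortComplex.quasiIso_of_epi_of_isIso_of_mono ψ
  rw [quasiIsoAt_iff_isIso_homologyMap] at quasiIsoAt
  exact (NatIso.isIso_map_iff
    (HomotopyCategory.homologyFunctorFactors A (ComplexShape.up ℤ) n) Fφ).2 quasiIsoAt

end RelativeHomology

section HomologicalFunctor

variable {C A : Type*} [Category* C] [HasZeroObject C] [Preadditive C] [HasShift C ℤ]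
  [∀ n : ℤ, (shiftFunctor C n).Additive] [Pretriangulated C] [Category* A] [Abelian A]
  (F : C ⥤ A) [F.IsHomological]

-- The fibre `N ⟶ S.X₂` of `S.g` is a weak kernel whose image under `F` is exact, and it factors
-- through `S.f` by weak exactness.
lemma IsWeaklyExact.map_exact {S : ShortComplex C} (hS : IsWeaklyExact S) : (S.map F).Exact := by
  obtain ⟨N, i, δ, hT⟩ := distinguished_cocone_triangle₁ S.g
  obtain ⟨y, hy⟩ := hS i (comp_distTriang_mor_zero₁₂ _ hT)
  have exact_fibre := F.map_distinguished_exact _ hT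
  rw [ShortComplex.exact_iff_exact_up_to_refinements] at exact_fibre ⊢
  intro P x hx
  obtain ⟨P', π, hπ, z, hz⟩ := exact_fibre x hx
  have map_i : F.map i = F.map y ≫ F.map S.f := by rw [← F.map_comp, hy]
  change P' ⟶ F.obj N at z
  exact ⟨P', π, hπ, z ≫ F.map y, hz.trans ((z ≫= map_i).trans (assoc _ _ _).symm)⟩

lemma IsWeaklyExactUpTo.homologyGE_relHomology {K : CochainComplex C ℤ} {n : ℤ}
    (hK : IsWeaklyExactUpTo n K) :
    homologyGE (relHomology F) (n + 1) ((HomotopyCategory.quotient C _).obj K) := by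
  intro m hm
  rw [isZero_relHomology_shift_obj_iff,
    HomologicalComplex.exactAt_iff' _ (m - 1) m (m + 1) (by simp) (by simp)]
  exact (hK (m - 1) m (m + 1) (by lia) rfl (by lia)).map_exact F

lemma hasWeakTruncations_relHomology (n : ℤ) :
    HasWeakTruncations (relHomology F) n (fun K => IsWeaklyExactUpTo n K.as) := by
  intro K
  obtain ⟨K, rfl⟩ := HomotopyCategory.quotient_obj_surjective K
  obtain ⟨L, π, hπ, hL⟩ := exists_weakTruncation K n
  refine ⟨(HomotopyCategory.quotient C _).obj L, (HomotopyCategory.quotient C _).map π, hL,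
    ⟨hL.homologyGE_relHomology F, fun m hm =>
      isIso_relHomology_shift_map F π fun i hi => hπ i (by lia)⟩, fun M hM f => ?_⟩
  obtain ⟨M, rfl⟩ := HomotopyCategory.quotient_obj_surjective M
  obtain ⟨f, rfl⟩ := (HomotopyCategory.quotient C _).map_surjective f
  obtain ⟨g, ⟨h⟩⟩ := hM.exists_factorization_up_to_homotopy π hπ f
  exact ⟨(HomotopyCategory.quotient C _).map g,
    ((HomotopyCategory.quotient C _).map_comp π g).symm.trans
      (HomotopyCategory.eq_of_homotopy _ _ h)⟩

end HomologicalFunctor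

section RelativeDerivedCategory

variable {A : Type w} [Category.{w'} A] [Abelian A]
  {T : Type u} [Category.{v} T] [Preadditive T] [HasZeroObject T] [HasShift T ℤ]
  [∀ n : ℤ, (shiftFunctor T n).Additive] [Pretriangulated T]

/-- Relative exactness of complexes with respect to the ideal `I` is exactness of their images
under `F`. The sign passes from the homological indexing of `IsExactInDegree` to cochain complexes.
-/
def DetectsExactness (F : T ⥤ A) [F.Additive] (I : MorphismIdeal T) : Prop :=
  ∀ K n, IsExactInDegree I K n ↔
    ((F.mapHomologicalComplex (ComplexShape.up ℤ)).obj K).ExactAt (-n)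

lemma HomologicalIdeal.exists_detectsExactness (I : HomologicalIdeal.{w', w} T) :
    ∃ (A : Type w) (_ : Category.{w'} A) (_ : Abelian A) (F : T ⥤ A) (_ : F.IsHomological),
      DetectsExactness F I.toMorphismIdeal := by
  obtain ⟨A, _, _, S, F, _, ⟨e⟩, hI⟩ := I.isHomological
  exact ⟨A, inferInstance, inferInstance, F, inferInstance, isExactInDegree_iff S F e hI⟩

namespace DetectsExactness

variable {F : T ⥤ A} [F.Additive] {I : HomologicalIdeal.{w', w} T}
  (hF : DetectsExactness F I.toMorphismIdeal)
include hF

lemma isExactInDegree_iff (K : CochainComplex T ℤ) (n : ℤ) :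
    IsExactInDegree I.toMorphismIdeal K n ↔
      IsZero (((relHomology F).shift (-n)).obj ((HomotopyCategory.quotient T _).obj K)) :=
  (hF K n).trans (isZero_relHomology_shift_obj_iff F K (-n)).symm

lemma exactComplexes_eq :
    exactComplexes I.toMorphismIdeal = (relHomology F).homologicalKernel := by
  ext K
  obtain ⟨K, rfl⟩ := HomotopyCategory.quotient_obj_surjective K
  rw [(relHomology F).mem_homologicalKernel_iff, ← (Equiv.neg ℤ).forall_congr_right]
  exact forall_congr' (hF.isExactInDegree_iff K)

lemma exists_iso_ofComplex_iff (p : ℤ → Prop) (X : Der I) :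
    (∃ K, Nonempty (X ≅ Der.ofComplex I K) ∧
        ∀ m, p m → IsExactInDegree I.toMorphismIdeal K m) ↔
      ObjectProperty.map (fun K => ∀ m, p (-m) → IsZero (((relHomology F).shift m).obj K))
        (exactComplexes I.toMorphismIdeal).trW.Q X := by
  constructor
  · rintro ⟨K, ⟨e⟩, hK⟩
    refine ⟨_, fun m hm => ?_, ⟨e.symm⟩⟩
    simpa using (hF.isExactInDegree_iff K (-m)).1 (hK (-m) hm)
  · rintro ⟨K, hK, ⟨e⟩⟩
    obtain ⟨K, rfl⟩ := HomotopyCategory.quotient_obj_surjective K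
    exact ⟨K, ⟨e.symm⟩, fun m hm =>
      (hF.isExactInDegree_iff K m).2 (hK (-m) (by rwa [neg_neg]))⟩

lemma derGE_eq (n : ℤ) : RelHomAlg.derGE I n =
    (homologyLE (relHomology F) (-n)).map (exactComplexes I.toMorphismIdeal).trW.Q := by
  ext X
  have h := hF.exists_iso_ofComplex_iff (· < n) X
  simp only [neg_lt] at h
  exact h

lemma derLE_eq (n : ℤ) : RelHomAlg.derLE I n =
    (homologyGE (relHomology F) (-n)).map (exactComplexes I.toMorphismIdeal).trW.Q := by
  ext X
  have h := hF.exists_iso_ofComplex_iff (n < ·) X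
  simp only [lt_neg] at h
  exact h

end DetectsExactness

end RelativeDerivedCategory

end RelHomAlg

end

theorem theorem3_general {T : Type u} [Category.{v} T] [Preadditive T] [HasZeroObject T]
    [HasShift T ℤ] [∀ n : ℤ, (shiftFunctor T n).Additive] [Pretriangulated T]
    (I : RelHomAlg.HomologicalIdeal.{w', w} T) :
    ∃ t : TStructure (RelHomAlg.Der I),
      ∀ n : ℤ, t.le (-n) = RelHomAlg.derGE I n ∧ t.ge (-n) = RelHomAlg.derLE I n := by
  obtain ⟨A, _, _, F, _, hF⟩ := I.exists_detectsExactness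
  let Q := (RelHomAlg.exactComplexes I.toMorphismIdeal).trW.Q
  have : Q.IsLocalization (RelHomAlg.relHomology F).homologicalKernel.trW :=
    hF.exactComplexes_eq ▸ inferInstance
  exact ⟨RelHomAlg.truncationTStructure Q (RelHomAlg.hasWeakTruncations_relHomology F 0),
    fun n => ⟨(hF.derGE_eq n).symm, (hF.derLE_eq n).symm⟩⟩

theorem theorem3 {T : Type u} [Category.{v} T] [Preadditive T] [HasZeroObject T] [HasShift T ℤ]
    [∀ n : ℤ, (shiftFunctor T n).Additive] [Pretriangulated T] [IsTriangulated T]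
    (I : RelHomAlg.HomologicalIdeal.{w', w} T) :
    ∃ t : TStructure (RelHomAlg.Der I),
      ∀ n : ℤ, t.le (-n) = RelHomAlg.derGE I n ∧ t.ge (-n) = RelHomAlg.derLE I n :=
  theorem3_general I
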